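/- Let $H\in(\tfrac12,1)$ and let $S^H=(S^H_t)_{t\ge 0}$ be a sub-fractional Brownian motion, i.e. a centered Gaussian process with $S_0^H=0$, continuous paths and covariance $\mathbf E(S^H_tS^H_s)=s^{2H}+t^{2H}-\tfrac12\{|s-t|^{2H}+(s+t)^{2H}\}$. Let $x_0,\mu_0,\theta_0\in\mathbb R$ with $\mu_0+\theta_0x_0\neq 0$. For each $\sigma>0$ let $X=X^\sigma$ be the (continuous) solution of $$dX_t=(\mu_0+\theta_0X_t)\,dt+\sigma\,dS^H_t,\quad t\ge 0,\qquad X_0=x_0,$$ that is, almost surely $X_t=x_0+\int_0^t(\mu_0+\theta_0X_s)\,ds+\sigma S_t^H$ for all $t\ge0$. Let $X^0_t=\frac{\mu_0}{\theta_0}(e^{\theta_0t}-1)+x_0e^{\theta_0t}$ (read as $x_0+\mu_0t$ if $\theta_0=0$) be the noiseless solution. With $t_i=i/n$, let $$\hat\theta=\frac{\sum_{i=1}^n(X_{t_i}-X_{t_{i-1}})X_{t_{i-1}}-\frac1n\sum_{i=1}^nX_{t_{i-1}}\sum_{i=1}^n(X_{t_i}-X_{t_{i-1}})}{\frac1n\sum_{i=1}^nX_{t_{i-1}}^2-\frac1{n^2}\bigl(\sum_{i=1}^nX_{t_{i-1}}\bigr)^2},$$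 $$\hat\mu=\frac{\sum_{i=1}^n(X_{t_i}-X_{t_{i-1}})\sum_{i=1}^nX_{t_{i-1}}^2-\sum_{i=1}^nX_{t_{i-1}}\sum_{i=1}^n(X_{t_i}-X_{t_{i-1}})X_{t_{i-1}}}{\sum_{i=1}^nX_{t_{i-1}}^2-\frac1n\bigl(\sum_{i=1}^nX_{t_{i-1}}\bigr)^2}$$ be the least squares estimators of $\theta_0,\mu_0$ based on $X_{t_0},\dots,X_{t_n}$. Then the Riemann–Stieltjes integral $\int_0^1X^0_s\,dS^H_s$ exists almost surely, and as $n\to\infty$, $\sigma\to0^+$ and $n\sigma\to\infty$, $$\sigma^{-1}(\hat\theta-\theta_0)\to\frac{\int_0^1X_s^0\,dS_s^H-S_1^H\int_0^1X_s^0\,ds}{\int_0^1(X_s^0)^2ds-\bigl(\int_0^1X_s^0ds\bigr)^2},\qquad \sigma^{-1}(\hat\mu-\mu_0)\to\frac{S_1^H\int_0^1(X_s^0)^2ds-\int_0^1X_s^0ds\int_0^1X_s^0\,dS_s^H}{\int_0^1(X_s^0)^2ds-\bigl(\int_0^1X_s^0ds\bigr)^2}.$$ Precisely: for all sequences $n_k\to\infty$,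 $\sigma_k\to0$, $\sigma_k>0$, with $n_k\sigma_k\to\infty$, both convergences hold almost surely, and the pair of rescaled errors converges jointly in distribution to the pair of limits. If moreover, almost surely, the integral equation for $X^\sigma$ holds for all $\sigma>0$ simultaneously, then almost surely both convergences hold as $(n,\sigma)$ tends to its limit in the sense $n\to\infty$, $\sigma\to0^+$, $n\sigma\to\infty$. -/

import Mathlib

open MeasureTheory ProbabilityTheory Filter Topology

noncomputable section

/-- `S` (restricted to times `t ≥ 0`) is a sub-fractional Brownian motion with index `H`: a centered
Gaussian process started at `0`, with the sub-fractional covariance and continuous sample paths. -/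
structure IsSubFBm {Ω : Type*} [MeasurableSpace Ω] (H : ℝ) (S : ℝ → Ω → ℝ) (P : Measure Ω) :
    Prop where
  gaussian : IsGaussianProcess (fun t : NNReal => S (t : ℝ)) P
  zero : ∀ᵐ ω ∂P, S 0 ω = 0
  mean : ∀ t : ℝ, 0 ≤ t → ∫ ω, S t ω ∂P = 0
  cov : ∀ s t : ℝ, 0 ≤ s → 0 ≤ t →
    ∫ ω, S t ω * S s ω ∂P =
      s ^ (2 * H) + t ^ (2 * H) - (1 / 2) * (|s - t| ^ (2 * H) + (s + t) ^ (2 * H))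
  cont : ∀ᵐ ω ∂P, ContinuousOn (fun t => S t ω) (Set.Ici 0)

/-- `x` is a (continuous) solution on `[0, ∞)` of `dx = (μ + θ x) dt + σ ds`, `x 0 = x₀`, driven by
the path `s` with `s 0 = 0`, i.e. of the integral equation
`x t = x₀ + ∫_0^t (μ + θ x u) du + σ s t`. -/
structure IsVasicekPath (x₀ μ θ σ : ℝ) (s x : ℝ → ℝ) : Prop where
  cont : ContinuousOn x (Set.Ici 0)
  eqn : ∀ t : ℝ, 0 ≤ t → x t = x₀ + (∫ u in (0 : ℝ)..t, (μ + θ * x u)) + σ * s t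

/-- The solution of the noiseless equation `dx = (μ + θ x) dt`, `x 0 = x₀`. -/
def noiselessPath (x₀ μ θ t : ℝ) : ℝ :=
  if θ = 0 then x₀ + μ * t
  else μ / θ * (Real.exp (θ * t) - 1) + x₀ * Real.exp (θ * t)

/-- The least squares estimator of `θ` from the observations `x (i / n)`, `i = 0, …, n`; the
summation index `i` is shifted by one, so that it runs over `0, …, n - 1`. -/
def lseTheta (n : ℕ) (x : ℝ → ℝ) : ℝ :=
  ((∑ i ∈ Finset.range n, (x ((i + 1 : ℝ) / n) - x ((i : ℝ) / n)) * x ((i : ℝ) / n))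
      - 1 / (n : ℝ) * (∑ i ∈ Finset.range n, x ((i : ℝ) / n))
        * ∑ i ∈ Finset.range n, (x ((i + 1 : ℝ) / n) - x ((i : ℝ) / n)))
    / (1 / (n : ℝ) * (∑ i ∈ Finset.range n, x ((i : ℝ) / n) ^ 2)
      - 1 / (n : ℝ) ^ 2 * (∑ i ∈ Finset.range n, x ((i : ℝ) / n)) ^ 2)

/-- The least squares estimator of `μ` from the observations `x (i / n)`, `i = 0, …, n`. -/
def lseMu (n : ℕ) (x : ℝ → ℝ) : ℝ :=
  ((∑ i ∈ Finset.range n, (x ((i + 1 : ℝ) / n) - x ((i : ℝ) / n)))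
        * (∑ i ∈ Finset.range n, x ((i : ℝ) / n) ^ 2)
      - (∑ i ∈ Finset.range n, x ((i : ℝ) / n))
        * ∑ i ∈ Finset.range n, (x ((i + 1 : ℝ) / n) - x ((i : ℝ) / n)) * x ((i : ℝ) / n))
    / ((∑ i ∈ Finset.range n, x ((i : ℝ) / n) ^ 2)
      - 1 / (n : ℝ) * (∑ i ∈ Finset.range n, x ((i : ℝ) / n)) ^ 2)

/-- `I` is the Riemann–Stieltjes integral `∫_a^b f dg`: the limit, as the mesh tends to `0`, of the
sums `∑ f (ξ i) (g (t (i + 1)) - g (t i))` over the tagged partitions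
`a = t 0 ≤ t 1 ≤ ⋯ ≤ t m = b`, `t i ≤ ξ i ≤ t (i + 1)`. -/
def HasRSIntegral (f g : ℝ → ℝ) (a b I : ℝ) : Prop :=
  ∀ ε > 0, ∃ δ > 0, ∀ (m : ℕ) (t ξ : ℕ → ℝ), t 0 = a → t m = b →
    (∀ i < m, t i ≤ ξ i ∧ ξ i ≤ t (i + 1) ∧ t (i + 1) - t i < δ) →
    |(∑ i ∈ Finset.range m, f (ξ i) * (g (t (i + 1)) - g (t i))) - I| < ε

/-- The common denominator `∫_0^1 (X⁰)² ds - (∫_0^1 X⁰ ds)²` of the two limits. -/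
def limitDenom (x₀ μ θ : ℝ) : ℝ :=
  (∫ s in (0 : ℝ)..1, noiselessPath x₀ μ θ s ^ 2)
    - (∫ s in (0 : ℝ)..1, noiselessPath x₀ μ θ s) ^ 2

/-- The limit for `θ`, where `J` stands for `∫_0^1 X⁰ dS` and `s₁` for `∫_0^1 dS`. -/
def thetaLimit (x₀ μ θ J s₁ : ℝ) : ℝ :=
  (J - (∫ s in (0 : ℝ)..1, noiselessPath x₀ μ θ s) * s₁) / limitDenom x₀ μ θ

/-- The limit for `μ`, where `J` stands for `∫_0^1 X⁰ dS` and `s₁` for `∫_0^1 dS`. -/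
def muLimit (x₀ μ θ J s₁ : ℝ) : ℝ :=
  ((∫ s in (0 : ℝ)..1, noiselessPath x₀ μ θ s ^ 2) * s₁
      - (∫ s in (0 : ℝ)..1, noiselessPath x₀ μ θ s) * J) / limitDenom x₀ μ θ

/-- The limiting regime `n → ∞`, `σ → 0+`, `n σ → ∞` for the pair `(n, σ)`. -/
def smallNoise : Filter (ℕ × ℝ) :=
  (atTop ×ˢ 𝓝[>] (0 : ℝ)) ⊓ comap (fun p : ℕ × ℝ => (p.1 : ℝ) * p.2) atTop

end

/-!
The argument is pathwise. By variation of constants (`IsVasicekPath.eq_noiselessPath_add`) the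
solution is affine in the noise level: `X^σ = X⁰ + σ Y` with `Y = S + z` and `z' = θ (S + z)`, so that
one continuous path `Y` serves every `σ`.

Write each increment of `X^σ` on the grid as its Euler step `(μ + θ X) / n` plus a residual. The least
squares estimators are exact on Euler steps, so their errors are rational expressions in the two
residual sums `∑ e_i`, `∑ e_i X_i` and the empirical moments of `X`
(`lseTheta_sub_eq`, `lseMu_sub_eq`). The empirical moments converge to those of `X⁰`, whose variance
on `[0, 1]` is positive because `X⁰` is strictly monotone. A residual consists of `σ ΔS_i`, of the
quadrature error of the noiseless drift, which sums to `O(1 / n) = o(σ)`, and of `σ` times the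
quadrature error of `Y`, which sums to `o(σ)` by uniform continuity
(`tendsto_sum_eulerResidual_sub`). Hence `σ⁻¹ ∑ e_i → S_1`, while `σ⁻¹ ∑ e_i X_i` behaves like
`∑ ΔS_i X⁰_i + σ ∑ ΔS_i (S_i + z_i)`. The sums with the continuously differentiable integrands `X⁰`
and `z` converge to Riemann–Stieltjes integrals by integration by parts
(`hasRSIntegral_of_hasDerivAt`), and `∑ ΔS_i S_i` stays bounded because it differs from `S_1² / 2` by
half the quadratic variation.

Probability enters only through that quadratic variation: since `H > 1 / 2`, Gaussian moments of high
order have summable expectations along the grids, and the quadratic variation tends to `0` almost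
surely (`IsSubFBm.ae_tendsto_quadraticVariation`). Convergence in distribution follows from almost
sure convergence of the pair.
-/

/-! ### Riemann–Stieltjes sums -/

/-- Integration by parts: a continuously differentiable integrand is Riemann–Stieltjes integrable
against any continuous integrator. -/
theorem hasRSIntegral_of_hasDerivAt {f f' g : ℝ → ℝ} {a b : ℝ} (hf : ∀ t, HasDerivAt f (f' t) t)
    (hf' : Continuous f') (hg : ContinuousOn g (Set.Icc a b)) :
    HasRSIntegral f g a b (f b * g b - f a * g a - ∫ t in a..b, g t * f' t) := by
  intro ε hε
  obtain ⟨K, hK⟩ := isCompact_Icc.exists_bound_of_continuousOn (s := Set.Icc a b) hf'.continuousOn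
  -- `K` may be negative when `Icc a b` is empty.
  set K' := max K 0 with hK'
  have hK0 : 0 ≤ K' := le_max_right _ _
  set η := ε / (K' * |b - a| + 1) with hη
  have hηp : 0 < η := by positivity
  obtain ⟨δ, hδ, hu⟩ := Metric.uniformContinuousOn_iff.1
    (isCompact_Icc.uniformContinuousOn_of_continuous hg) η hηp
  refine ⟨δ, hδ, fun m t ξ h0 hm h => ?_⟩
  have hstep : ∀ i < m, t i ≤ t (i + 1) := fun i hi => (h i hi).1.trans (h i hi).2.1
  have hlow : ∀ i ≤ m, a ≤ t i := by
    intro i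
    induction i with
    | zero => intro _; exact h0.ge
    | succ k ih => intro hk; exact (ih (by omega)).trans (hstep k (by omega))
  have hup : ∀ j i, i + j = m → t i ≤ b := by
    intro j
    induction j with
    | zero => intro i hi; rw [← hm, ← hi]; simp
    | succ k ih => intro i hi; exact (hstep i (by omega)).trans (ih (i + 1) (by omega))
  have hmem : ∀ i ≤ m, t i ∈ Set.Icc a b := fun i hi => ⟨hlow i hi, hup (m - i) i (by omega)⟩
  have hsub : ∀ {p q}, p ∈ Set.Icc a b → q ∈ Set.Icc a b → Set.uIcc p q ⊆ Set.Icc a b :=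
    fun hp hq => Set.OrdConnected.uIcc_subset Set.ordConnected_Icc hp hq
  have hint : ∀ {p q}, p ∈ Set.Icc a b → q ∈ Set.Icc a b →
      IntervalIntegrable (fun u => g u * f' u) volume p q := fun hp hq =>
    ((hg.mono (hsub hp hq)).mul hf'.continuousOn).intervalIntegrable
  have hsplit : ∫ u in a..b, g u * f' u
      = ∑ i ∈ Finset.range m, ∫ u in t i..t (i + 1), g u * f' u := by
    rw [intervalIntegral.sum_integral_adjacent_intervals, h0, hm]
    exact fun k hk => hint (hmem k hk.le) (hmem (k + 1) hk)
  have htel : f b * g b - f a * g a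
      = ∑ i ∈ Finset.range m, (f (t (i + 1)) * g (t (i + 1)) - f (t i) * g (t i)) := by
    rw [Finset.sum_range_sub (fun i => f (t i) * g (t i)), h0, hm]
  have hlen : ∑ i ∈ Finset.range m, (t (i + 1) - t i) = b - a := by
    rw [Finset.sum_range_sub, h0, hm]
  have hftc : ∀ p q, ∫ u in p..q, f' u = f q - f p := fun p q =>
    intervalIntegral.integral_eq_sub_of_hasDerivAt (fun u _ => hf u) (hf'.intervalIntegrable _ _)
  have hterm : ∀ i ∈ Finset.range m,
      |f (ξ i) * (g (t (i + 1)) - g (t i)) - (f (t (i + 1)) * g (t (i + 1)) - f (t i) * g (t i))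
        + ∫ u in t i..t (i + 1), g u * f' u| ≤ η * K' * (t (i + 1) - t i) := by
    intro i hi
    have hi := Finset.mem_range.1 hi
    obtain ⟨h1, h2, h3⟩ := h i hi
    have m0 := hmem i hi.le
    have m1 := hmem (i + 1) hi
    have mξ : ξ i ∈ Set.Icc a b := ⟨m0.1.trans h1, h2.trans m1.2⟩
    -- On each side of the tag, `g` is compared with its value at the partition point on that side.
    have key : ∀ c p q, c ∈ Set.Icc a b → p ∈ Set.Icc a b → q ∈ Set.Icc a b → p ≤ q →
        (∀ u ∈ Set.Ioc p q, |u - c| < δ) →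
        |(∫ u in p..q, g u * f' u) - g c * (f q - f p)| ≤ η * K' * (q - p) := by
      intro c p q hc hp hq hpq hcu
      rw [← hftc, ← intervalIntegral.integral_const_mul, ← intervalIntegral.integral_sub
        (hint hp hq) ((hf'.intervalIntegrable _ _).const_mul _)]
      have := intervalIntegral.norm_integral_le_of_norm_le_const (a := p) (b := q)
        (f := fun u => g u * f' u - g c * f' u) (C := η * K') (by
          intro u hui
          rw [Set.uIoc_of_le hpq] at hui
          have mu : u ∈ Set.Icc a b := ⟨hp.1.trans hui.1.le, hui.2.trans hq.2⟩
          rw [← sub_mul, norm_mul]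
          refine mul_le_mul ?_ ((hK u mu).trans (le_max_left _ _)) (norm_nonneg _) hηp.le
          exact (hu u mu c hc (hcu u hui)).le)
      rwa [abs_of_nonneg (sub_nonneg.2 hpq)] at this
    have e1 := key (t i) (t i) (ξ i) m0 m0 mξ h1 (fun u hu => by
      rw [abs_lt]; constructor <;> linarith [hu.1, hu.2])
    have e2 := key (t (i + 1)) (ξ i) (t (i + 1)) m1 mξ m1 h2 (fun u hu => by
      rw [abs_lt]; constructor <;> linarith [hu.1, hu.2])
    rw [← intervalIntegral.integral_add_adjacent_intervals (hint m0 mξ) (hint mξ m1)]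
    have : f (ξ i) * (g (t (i + 1)) - g (t i))
        - (f (t (i + 1)) * g (t (i + 1)) - f (t i) * g (t i))
        + ((∫ u in t i..ξ i, g u * f' u) + ∫ u in ξ i..t (i + 1), g u * f' u)
        = ((∫ u in t i..ξ i, g u * f' u) - g (t i) * (f (ξ i) - f (t i)))
          + ((∫ u in ξ i..t (i + 1), g u * f' u)
            - g (t (i + 1)) * (f (t (i + 1)) - f (ξ i))) := by ring
    rw [this]
    refine (abs_add_le _ _).trans ((add_le_add e1 e2).trans (le_of_eq (by ring)))
  rw [htel, hsplit, ← Finset.sum_sub_distrib, ← Finset.sum_sub_distrib]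
  have hle : η * K' * (b - a) < ε := by
    have : η * (K' * |b - a| + 1) = ε := by rw [hη]; field_simp
    nlinarith [mul_le_mul_of_nonneg_left (le_abs_self (b - a)) (mul_nonneg hηp.le hK0)]
  refine lt_of_le_of_lt ((Finset.abs_sum_le_sum_abs _ _).trans ?_) hle
  rw [← hlen, Finset.mul_sum]
  refine Finset.sum_le_sum fun i hi => le_trans (le_of_eq ?_) (hterm i hi)
  congr 1; ring

theorem HasRSIntegral.tendsto_sum_grid {f g : ℝ → ℝ} {I : ℝ} (h : HasRSIntegral f g 0 1 I) :
    Tendsto (fun n : ℕ => ∑ i ∈ Finset.range n,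
      f ((i : ℝ) / n) * (g ((i + 1 : ℝ) / n) - g ((i : ℝ) / n))) atTop (𝓝 I) := by
  rw [Metric.tendsto_atTop]
  intro ε hε
  obtain ⟨δ, hδ, hI⟩ := h ε hε
  obtain ⟨N, hN⟩ := exists_nat_one_div_lt hδ
  refine ⟨N + 1, fun n hn => ?_⟩
  have hn0 : (0 : ℝ) < n := by exact_mod_cast (Nat.succ_pos N).trans_le hn
  have hlt : 1 / (n : ℝ) < δ := lt_of_le_of_lt (by
    gcongr; exact_mod_cast hn) hN
  have := hI n (fun i => (i : ℝ) / n) (fun i => (i : ℝ) / n) (by simp) (div_self hn0.ne')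
    (fun i _ => by
      refine ⟨le_rfl, by push_cast; gcongr; linarith, ?_⟩
      push_cast
      rw [add_div, add_sub_cancel_left]; exact hlt)
  rw [Real.dist_eq]
  simpa using this

/-! ### The left-endpoint rule on a uniform grid -/

/-- The error `∫_{i/n}^{(i+1)/n} (f u - f (i / n)) du` of the left-endpoint rule on the `i`-th cell
of the uniform grid of mesh `1 / n`. -/
noncomputable def cellError (f : ℝ → ℝ) (n i : ℕ) : ℝ :=
  ∫ u in (i : ℝ) / n..(i + 1 : ℝ) / n, (f u - f ((i : ℝ) / n))

theorem cellError_eq {f : ℝ → ℝ} (hf : Continuous f) {n : ℕ} (i : ℕ) :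
    cellError f n i
      = (∫ u in (i : ℝ) / n..(i + 1 : ℝ) / n, f u) - f ((i : ℝ) / n) / n := by
  unfold cellError
  rw [intervalIntegral.integral_sub (hf.intervalIntegrable _ _) (by simp)]
  simp only [intervalIntegral.integral_const, smul_eq_mul]
  ring

theorem grid_mem_Icc {n i : ℕ} (hi : i < n) : (i : ℝ) / n ∈ Set.Icc (0 : ℝ) 1 := by
  have : (i : ℝ) ≤ n := by exact_mod_cast hi.le
  exact ⟨by positivity, div_le_one_of_le₀ this (by positivity)⟩

theorem mem_Icc_of_mem_cell {n i : ℕ} (hi : i < n) {u : ℝ}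
    (hu : u ∈ Set.Ioc ((i : ℝ) / n) ((i + 1 : ℝ) / n)) : u ∈ Set.Icc (0 : ℝ) 1 := by
  have h : ((i : ℝ) + 1) ≤ n := by exact_mod_cast hi
  exact ⟨(grid_mem_Icc hi).1.trans hu.1.le, hu.2.trans (div_le_one_of_le₀ h (by positivity))⟩

theorem abs_cellError_le {f : ℝ → ℝ} {n i : ℕ} {C : ℝ}
    (h : ∀ u ∈ Set.Ioc ((i : ℝ) / n) ((i + 1 : ℝ) / n), |f u - f ((i : ℝ) / n)| ≤ C) :
    |cellError f n i| ≤ C * (1 / n) := by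
  have hle : (i : ℝ) / n ≤ (i + 1 : ℝ) / n := by gcongr; linarith
  have := intervalIntegral.norm_integral_le_of_norm_le_const (a := (i : ℝ) / n)
    (b := (i + 1 : ℝ) / n) (f := fun u => f u - f ((i : ℝ) / n)) (C := C)
    (by rw [Set.uIoc_of_le hle]; exact h)
  rwa [abs_of_nonneg (sub_nonneg.2 hle), ← sub_div, add_sub_cancel_left] at this

theorem tendsto_sum_abs_cellError {f : ℝ → ℝ} (hf : Continuous f) :
    Tendsto (fun n : ℕ => ∑ i ∈ Finset.range n, |cellError f n i|) atTop (𝓝 0) := by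
  rw [Metric.tendsto_atTop]
  intro ε hε
  obtain ⟨δ, hδ, hu⟩ := Metric.uniformContinuousOn_iff.1
    ((isCompact_Icc (a := (0 : ℝ)) (b := 1)).uniformContinuousOn_of_continuous hf.continuousOn)
    (ε / 2) (half_pos hε)
  obtain ⟨N, hN⟩ := exists_nat_one_div_lt hδ
  refine ⟨N + 1, fun n hn => ?_⟩
  have hn0 : (0 : ℝ) < n := by exact_mod_cast (Nat.succ_pos N).trans_le hn
  have hlt : 1 / (n : ℝ) < δ := lt_of_le_of_lt (by
    gcongr; exact_mod_cast hn) hN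
  rw [Real.dist_eq, sub_zero, abs_of_nonneg (Finset.sum_nonneg fun i _ => abs_nonneg _)]
  have : ∑ i ∈ Finset.range n, |cellError f n i| ≤ ∑ i ∈ Finset.range n, ε / 2 * (1 / n) := by
    refine Finset.sum_le_sum fun i hi => abs_cellError_le fun u hui => ?_
    have hi := Finset.mem_range.1 hi
    refine (hu u (mem_Icc_of_mem_cell hi hui) _ (grid_mem_Icc hi) ?_).le
    rw [add_div] at hui
    rw [Real.dist_eq, abs_lt]; constructor <;> linarith [hui.1, hui.2]
  refine lt_of_le_of_lt this ?_
  rw [Finset.sum_const, Finset.card_range, nsmul_eq_mul]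
  have : (n : ℝ) * (ε / 2 * (1 / n)) = ε / 2 := by field_simp
  linarith

/-- For a continuously differentiable function the total error of the left-endpoint rule is
`O(1 / n)`; it is this rate that the condition `n σ → ∞` turns into `o(σ)`. -/
theorem exists_sum_abs_cellError_le {f f' : ℝ → ℝ} (hf : ∀ t, HasDerivAt f (f' t) t)
    (hf' : Continuous f') :
    ∃ C, ∀ n : ℕ, n * ∑ i ∈ Finset.range n, |cellError f n i| ≤ C := by
  obtain ⟨K, hK⟩ := isCompact_Icc.exists_bound_of_continuousOn
    (s := Set.Icc (0 : ℝ) 1) hf'.continuousOn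
  have hK0 : 0 ≤ K := (norm_nonneg _).trans (hK 0 (by simp))
  refine ⟨K, fun n => ?_⟩
  rcases Nat.eq_zero_or_pos n with rfl | hn
  · simpa using hK0
  have hn0 : (0 : ℝ) < n := by exact_mod_cast hn
  have : ∑ i ∈ Finset.range n, |cellError f n i|
      ≤ ∑ i ∈ Finset.range n, K * (1 / n) * (1 / n) := by
    refine Finset.sum_le_sum fun i hi => abs_cellError_le fun u hui => ?_
    have hi := Finset.mem_range.1 hi
    have hmv := (convex_Icc (0 : ℝ) 1).norm_image_sub_le_of_norm_hasDerivWithin_le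
      (fun t _ => (hf t).hasDerivWithinAt) hK (grid_mem_Icc hi) (mem_Icc_of_mem_cell hi hui)
    refine hmv.trans (mul_le_mul_of_nonneg_left ?_ hK0)
    rw [add_div] at hui
    rw [Real.norm_eq_abs, abs_of_nonneg] <;> linarith [hui.1, hui.2]
  rw [Finset.sum_const, Finset.card_range, nsmul_eq_mul] at this
  calc (n : ℝ) * ∑ i ∈ Finset.range n, |cellError f n i|
      ≤ n * (n * (K * (1 / n) * (1 / n))) := by gcongr
    _ = K := by field_simp

theorem tendsto_riemannSum {f : ℝ → ℝ} (hf : Continuous f) :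
    Tendsto (fun n : ℕ => 1 / (n : ℝ) * ∑ i ∈ Finset.range n, f ((i : ℝ) / n)) atTop
      (𝓝 (∫ u in (0 : ℝ)..1, f u)) := by
  have h : Tendsto (fun n : ℕ => ∑ i ∈ Finset.range n, cellError f n i) atTop (𝓝 0) :=
    squeeze_zero_norm (fun n => Finset.abs_sum_le_sum_abs _ _) (tendsto_sum_abs_cellError hf)
  have h2 := (tendsto_const_nhds (x := ∫ u in (0 : ℝ)..1, f u)).sub h
  rw [sub_zero] at h2
  refine h2.congr' ?_
  filter_upwards [eventually_gt_atTop 0] with n hn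
  have hn0 : (n : ℝ) ≠ 0 := by exact_mod_cast hn.ne'
  have hsplit := intervalIntegral.sum_integral_adjacent_intervals (μ := volume) (f := f)
    (a := fun i : ℕ => (i : ℝ) / n) (n := n) (fun k _ => hf.intervalIntegrable _ _)
  simp only [Nat.cast_zero, zero_div, div_self hn0, Nat.cast_add, Nat.cast_one] at hsplit
  simp_rw [cellError_eq hf]
  rw [Finset.sum_sub_distrib, hsplit, ← Finset.sum_div]
  ring

/-- The variance of a nonconstant continuous function under the uniform law on `[0, 1]` is positive. -/
theorem sq_integral_lt_integral_sq {f : ℝ → ℝ} (hf : Continuous f) (hne : f 0 ≠ f 1) :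
    (∫ u in (0 : ℝ)..1, f u) ^ 2 < ∫ u in (0 : ℝ)..1, f u ^ 2 := by
  set m := ∫ u in (0 : ℝ)..1, f u with hm
  have hi : ∫ u in (0 : ℝ)..1, (f u - m) ^ 2 = (∫ u in (0 : ℝ)..1, f u ^ 2) - m ^ 2 := by
    have : ∀ u, (f u - m) ^ 2 = f u ^ 2 - (2 * m * f u - m ^ 2) := fun u => by ring
    simp_rw [this]
    rw [intervalIntegral.integral_sub (by apply Continuous.intervalIntegrable; fun_prop)
      (by apply Continuous.intervalIntegrable; fun_prop),
      intervalIntegral.integral_sub (by apply Continuous.intervalIntegrable; fun_prop) (by simp),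
      intervalIntegral.integral_const_mul, ← hm]
    simp; ring
  have hc : ∃ c ∈ Set.Icc (0 : ℝ) 1, 0 < (f c - m) ^ 2 := by
    by_cases h0 : f 0 = m
    · exact ⟨1, by simp, by
        have : f 1 - m ≠ 0 := fun h => hne (by linarith)
        positivity⟩
    · exact ⟨0, by simp, by
        have : f 0 - m ≠ 0 := fun h => h0 (by linarith)
        positivity⟩
  have := intervalIntegral.integral_pos (f := fun u => (f u - m) ^ 2) zero_lt_one (by fun_prop)
    (fun u _ => sq_nonneg _) hc
  linarith

/-! ### Estimation errors in terms of Euler residuals -/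

/-- The deviation of the `i`-th increment of `x` on the grid of mesh `1 / n` from the Euler step of
the equation `dx = (μ + θ x) dt`. -/
noncomputable def eulerResidual (μ θ : ℝ) (n : ℕ) (x : ℝ → ℝ) (i : ℕ) : ℝ :=
  x ((i + 1 : ℝ) / n) - x ((i : ℝ) / n) - (μ + θ * x ((i : ℝ) / n)) / n

/-- The empirical variance of the observations `x (i / n)`, `i = 0, …, n - 1`. -/
noncomputable def gridVariance (n : ℕ) (x : ℝ → ℝ) : ℝ :=
  1 / (n : ℝ) * (∑ i ∈ Finset.range n, x ((i : ℝ) / n) ^ 2)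
    - (1 / (n : ℝ) * ∑ i ∈ Finset.range n, x ((i : ℝ) / n)) ^ 2

theorem sum_increment_eq (μ θ : ℝ) {n : ℕ} (x : ℝ → ℝ) (w : ℕ → ℝ) :
    ∑ i ∈ Finset.range n, (x ((i + 1 : ℝ) / n) - x ((i : ℝ) / n)) * w i
      = μ * (1 / (n : ℝ) * ∑ i ∈ Finset.range n, w i)
        + θ * (1 / (n : ℝ) * ∑ i ∈ Finset.range n, x ((i : ℝ) / n) * w i)
        + ∑ i ∈ Finset.range n, eulerResidual μ θ n x i * w i := by
  simp only [Finset.mul_sum, ← Finset.sum_add_distrib]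
  refine Finset.sum_congr rfl fun i _ => ?_
  unfold eulerResidual
  ring

theorem lseTheta_sub_eq (μ θ : ℝ) {n : ℕ} (hn : n ≠ 0) {x : ℝ → ℝ} (hD : gridVariance n x ≠ 0) :
    lseTheta n x - θ = ((∑ i ∈ Finset.range n, eulerResidual μ θ n x i * x ((i : ℝ) / n))
      - (1 / (n : ℝ) * ∑ i ∈ Finset.range n, x ((i : ℝ) / n))
        * ∑ i ∈ Finset.range n, eulerResidual μ θ n x i) / gridVariance n x := by
  have hn0 : (n : ℝ) ≠ 0 := by exact_mod_cast hn
  have h1 := sum_increment_eq μ θ (n := n) x (fun i => x ((i : ℝ) / n))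
  have h2 := sum_increment_eq μ θ (n := n) x (fun _ => 1)
  simp only [mul_one, Finset.sum_const, Finset.card_range, nsmul_eq_mul,
    one_div_mul_cancel hn0] at h2
  simp only [← pow_two] at h1
  rw [eq_div_iff hD, sub_mul]
  have hden : (1 / (n : ℝ) * (∑ i ∈ Finset.range n, x ((i : ℝ) / n) ^ 2)
      - 1 / (n : ℝ) ^ 2 * (∑ i ∈ Finset.range n, x ((i : ℝ) / n)) ^ 2) = gridVariance n x := by
    unfold gridVariance; ring
  unfold lseTheta
  rw [hden, div_mul_cancel₀ _ hD, h1, h2]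
  unfold gridVariance
  ring

theorem lseMu_sub_eq (μ θ : ℝ) {n : ℕ} (hn : n ≠ 0) {x : ℝ → ℝ} (hD : gridVariance n x ≠ 0) :
    lseMu n x - μ = ((1 / (n : ℝ) * ∑ i ∈ Finset.range n, x ((i : ℝ) / n) ^ 2)
        * (∑ i ∈ Finset.range n, eulerResidual μ θ n x i)
      - (1 / (n : ℝ) * ∑ i ∈ Finset.range n, x ((i : ℝ) / n))
        * ∑ i ∈ Finset.range n, eulerResidual μ θ n x i * x ((i : ℝ) / n))
        / gridVariance n x := by
  have hn0 : (n : ℝ) ≠ 0 := by exact_mod_cast hn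
  have h1 := sum_increment_eq μ θ (n := n) x (fun i => x ((i : ℝ) / n))
  have h2 := sum_increment_eq μ θ (n := n) x (fun _ => 1)
  simp only [mul_one, Finset.sum_const, Finset.card_range, nsmul_eq_mul,
    one_div_mul_cancel hn0] at h2
  simp only [← pow_two] at h1
  rw [eq_div_iff hD, sub_mul]
  have hden : ((∑ i ∈ Finset.range n, x ((i : ℝ) / n) ^ 2)
      - 1 / (n : ℝ) * (∑ i ∈ Finset.range n, x ((i : ℝ) / n)) ^ 2) = n * gridVariance n x := by
    unfold gridVariance; field_simp
  unfold lseMu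
  rw [hden, h1, h2, div_mul_eq_div_div, div_mul_cancel₀ _ hD]
  unfold gridVariance
  field_simp
  ring

/-! ### The small-noise limit along a path -/

theorem tendsto_smallNoise_iff {ι : Type*} {l : Filter ι} {n : ι → ℕ} {σ : ι → ℝ} :
    Tendsto (fun k => (n k, σ k)) l smallNoise ↔
      Tendsto n l atTop ∧ Tendsto σ l (𝓝[>] 0) ∧
        Tendsto (fun k => (n k : ℝ) * σ k) l atTop := by
  rw [smallNoise, tendsto_inf, tendsto_prod_iff', tendsto_comap_iff, and_assoc]
  rfl

theorem tendsto_fst_smallNoise : Tendsto Prod.fst smallNoise atTop :=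
  (tendsto_smallNoise_iff.1 (tendsto_id (α := ℕ × ℝ))).1

theorem tendsto_snd_smallNoise : Tendsto Prod.snd smallNoise (𝓝[>] (0 : ℝ)) :=
  (tendsto_smallNoise_iff.1 (tendsto_id (α := ℕ × ℝ))).2.1

theorem tendsto_mul_smallNoise :
    Tendsto (fun p : ℕ × ℝ => (p.1 : ℝ) * p.2) smallNoise atTop :=
  (tendsto_smallNoise_iff.1 (tendsto_id (α := ℕ × ℝ))).2.2

theorem eventually_pos_smallNoise : ∀ᶠ p : ℕ × ℝ in smallNoise, 0 < p.1 ∧ 0 < p.2 :=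
  (tendsto_fst_smallNoise.eventually (eventually_gt_atTop 0)).and
    (tendsto_snd_smallNoise.eventually self_mem_nhdsWithin)

theorem abs_sum_cellError_mul_le {f : ℝ → ℝ} {n : ℕ} {w : ℕ → ℝ} {M : ℝ}
    (hw : ∀ i < n, |w i| ≤ M) :
    |∑ i ∈ Finset.range n, cellError f n i * w i|
      ≤ (∑ i ∈ Finset.range n, |cellError f n i|) * M := by
  rw [Finset.sum_mul]
  refine (Finset.abs_sum_le_sum_abs _ _).trans (Finset.sum_le_sum fun i hi => ?_)
  rw [abs_mul]
  exact mul_le_mul_of_nonneg_left (hw i (Finset.mem_range.1 hi)) (abs_nonneg _)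

/-- The residual of `f + σ (s + z)` is the increment of `σ s`, up to the errors of the left-endpoint
rule for the two drift integrals. -/
theorem eulerResidual_add_smul {f s z : ℝ → ℝ} {μ θ : ℝ}
    (hf : ∀ t, HasDerivAt f (μ + θ * f t) t) (hs : Continuous s)
    (hz : ∀ t, HasDerivAt z (θ * (s t + z t)) t) (σ : ℝ) {n : ℕ} (hn : n ≠ 0) (i : ℕ) :
    eulerResidual μ θ n (fun t => f t + σ * (s t + z t)) i
      = θ * cellError f n i + σ * (s ((i + 1 : ℝ) / n) - s ((i : ℝ) / n))
        + σ * θ * cellError (fun t => s t + z t) n i := by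
  have hn0 : (n : ℝ) ≠ 0 := by exact_mod_cast hn
  have cf : Continuous f := continuous_iff_continuousAt.2 fun t => (hf t).continuousAt
  have cz : Continuous z := continuous_iff_continuousAt.2 fun t => (hz t).continuousAt
  have h1 : ∫ u in (i : ℝ) / n..(i + 1 : ℝ) / n, (μ + θ * f u)
      = f ((i + 1 : ℝ) / n) - f ((i : ℝ) / n) :=
    intervalIntegral.integral_eq_sub_of_hasDerivAt (fun u _ => hf u)
      (by apply Continuous.intervalIntegrable; fun_prop)
  have h2 : ∫ u in (i : ℝ) / n..(i + 1 : ℝ) / n, θ * (s u + z u)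
      = z ((i + 1 : ℝ) / n) - z ((i : ℝ) / n) :=
    intervalIntegral.integral_eq_sub_of_hasDerivAt (fun u _ => hz u)
      (by apply Continuous.intervalIntegrable; fun_prop)
  rw [intervalIntegral.integral_add (by simp)
    (by apply Continuous.intervalIntegrable; fun_prop), intervalIntegral.integral_const_mul] at h1
  rw [intervalIntegral.integral_const_mul] at h2
  rw [cellError_eq cf, cellError_eq (f := fun t => s t + z t) (by fun_prop), eulerResidual]
  simp only [intervalIntegral.integral_const, smul_eq_mul] at h1
  have h3 : ((i + 1 : ℝ) / n - i / n) = 1 / n := by ring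
  rw [h3] at h1
  linear_combination (-1 : ℝ) * h1 - σ * h2

/-- After division by `σ`, the residuals may be replaced by the increments of `s` in sums with bounded
weights: the noiseless drift contributes `O(1 / (n σ))`, and the perturbation `s + z` only its
quadrature error, without a rate. -/
theorem tendsto_sum_eulerResidual_sub {f s z : ℝ → ℝ} {μ θ : ℝ}
    (hf : ∀ t, HasDerivAt f (μ + θ * f t) t) (hs : Continuous s)
    (hz : ∀ t, HasDerivAt z (θ * (s t + z t)) t) {w : ℕ × ℝ → ℕ → ℝ} {M : ℝ}
    (hw : ∀ᶠ p in smallNoise, ∀ i < p.1, |w p i| ≤ M) :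
    Tendsto (fun p : ℕ × ℝ => p.2⁻¹ * (∑ i ∈ Finset.range p.1,
        eulerResidual μ θ p.1 (fun t => f t + p.2 * (s t + z t)) i * w p i)
      - ∑ i ∈ Finset.range p.1, (s ((i + 1 : ℝ) / p.1) - s ((i : ℝ) / p.1)) * w p i)
      smallNoise (𝓝 0) := by
  have cf : Continuous f := continuous_iff_continuousAt.2 fun t => (hf t).continuousAt
  have cz : Continuous z := continuous_iff_continuousAt.2 fun t => (hz t).continuousAt
  obtain ⟨C, hC⟩ := exists_sum_abs_cellError_le hf (by fun_prop)
  have hlim1 : Tendsto (fun p : ℕ × ℝ => |θ| * (((p.1 : ℝ) * p.2)⁻¹ * C * M)) smallNoise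
      (𝓝 0) := by
    have := ((tendsto_mul_smallNoise.inv_tendsto_atTop.mul_const C).mul_const M).const_mul |θ|
    simpa using this
  have hlim2 : Tendsto (fun p : ℕ × ℝ => |θ| * ((∑ i ∈ Finset.range p.1,
      |cellError (fun t => s t + z t) p.1 i|) * M)) smallNoise (𝓝 0) := by
    have := (((tendsto_sum_abs_cellError (f := fun t => s t + z t) (by fun_prop)).comp
      tendsto_fst_smallNoise).mul_const M).const_mul |θ|
    simpa using this
  have hlim := hlim1.add hlim2
  rw [add_zero] at hlim
  refine squeeze_zero_norm' ?_ hlim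
  filter_upwards [hw, eventually_pos_smallNoise] with p hp hpos
  obtain ⟨hn, hσ⟩ := hpos
  have hn0 : (0 : ℝ) < p.1 := by exact_mod_cast hn
  have hM : 0 ≤ M := (abs_nonneg _).trans (hp 0 hn)
  have heq : p.2⁻¹ * (∑ i ∈ Finset.range p.1,
        eulerResidual μ θ p.1 (fun t => f t + p.2 * (s t + z t)) i * w p i)
      - ∑ i ∈ Finset.range p.1, (s ((i + 1 : ℝ) / p.1) - s ((i : ℝ) / p.1)) * w p i
      = θ * (p.2⁻¹ * ∑ i ∈ Finset.range p.1, cellError f p.1 i * w p i)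
        + θ * ∑ i ∈ Finset.range p.1, cellError (fun t => s t + z t) p.1 i * w p i := by
    simp only [Finset.mul_sum, ← Finset.sum_add_distrib, ← Finset.sum_sub_distrib]
    refine Finset.sum_congr rfl fun i _ => ?_
    rw [eulerResidual_add_smul hf hs hz p.2 hn.ne']
    field_simp
    ring
  rw [heq, Real.norm_eq_abs]
  refine (abs_add_le _ _).trans (add_le_add ?_ ?_)
  · rw [abs_mul, abs_mul, abs_of_pos (inv_pos.2 hσ)]
    refine mul_le_mul_of_nonneg_left ?_ (abs_nonneg _)
    have hb : ∑ i ∈ Finset.range p.1, |cellError f p.1 i| ≤ (p.1 : ℝ)⁻¹ * C := by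
      rw [inv_mul_eq_div, le_div_iff₀ hn0, mul_comm]; exact hC _
    calc p.2⁻¹ * |∑ i ∈ Finset.range p.1, cellError f p.1 i * w p i|
        ≤ p.2⁻¹ * (((p.1 : ℝ)⁻¹ * C) * M) := by
          refine mul_le_mul_of_nonneg_left ?_ (inv_pos.2 hσ).le
          exact (abs_sum_cellError_mul_le hp).trans (mul_le_mul_of_nonneg_right hb hM)
      _ = ((p.1 : ℝ) * p.2)⁻¹ * C * M := by rw [mul_inv]; ring
  · rw [abs_mul]
    exact mul_le_mul_of_nonneg_left (abs_sum_cellError_mul_le hp) (abs_nonneg _)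

/-- Summation by parts; the left-endpoint sums of `∫ s ds` are controlled by the quadratic variation. -/
theorem sum_increment_mul_self (s : ℝ → ℝ) {n : ℕ} (hn : n ≠ 0) :
    ∑ i ∈ Finset.range n, (s ((i + 1 : ℝ) / n) - s ((i : ℝ) / n)) * s ((i : ℝ) / n)
      = (s 1 ^ 2 - s 0 ^ 2
        - ∑ i ∈ Finset.range n, (s ((i + 1 : ℝ) / n) - s ((i : ℝ) / n)) ^ 2) / 2 := by
  have hn0 : (n : ℝ) ≠ 0 := by exact_mod_cast hn
  have h := Finset.sum_range_sub (fun i : ℕ => s ((i : ℝ) / n) ^ 2) n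
  simp only [Nat.cast_add, Nat.cast_one, Nat.cast_zero, zero_div, div_self hn0] at h
  rw [← h, ← Finset.sum_sub_distrib, Finset.sum_div]
  exact Finset.sum_congr rfl fun i _ => by ring

/-- The deterministic limit theorem for the paths `f + σ (s + z)`, where `f` solves the noiseless
equation and `z' = θ (s + z)`. -/
theorem tendsto_lse {f s z : ℝ → ℝ} {μ θ : ℝ}
    (hf : ∀ t, HasDerivAt f (μ + θ * f t) t) (hf01 : f 0 ≠ f 1) (hs : Continuous s) (hs0 : s 0 = 0)
    (hz : ∀ t, HasDerivAt z (θ * (s t + z t)) t)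
    (hQ : Tendsto (fun n : ℕ => ∑ i ∈ Finset.range n,
      (s ((i + 1 : ℝ) / n) - s ((i : ℝ) / n)) ^ 2) atTop (𝓝 0))
    {J : ℝ} (hJ : HasRSIntegral f s 0 1 J) :
    Tendsto (fun p : ℕ × ℝ => p.2⁻¹ * (lseTheta p.1 (fun t => f t + p.2 * (s t + z t)) - θ))
      smallNoise (𝓝 ((J - (∫ u in (0 : ℝ)..1, f u) * s 1)
        / ((∫ u in (0 : ℝ)..1, f u ^ 2) - (∫ u in (0 : ℝ)..1, f u) ^ 2))) ∧
    Tendsto (fun p : ℕ × ℝ => p.2⁻¹ * (lseMu p.1 (fun t => f t + p.2 * (s t + z t)) - μ))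
      smallNoise (𝓝 (((∫ u in (0 : ℝ)..1, f u ^ 2) * s 1 - (∫ u in (0 : ℝ)..1, f u) * J)
        / ((∫ u in (0 : ℝ)..1, f u ^ 2) - (∫ u in (0 : ℝ)..1, f u) ^ 2))) := by
  have cf : Continuous f := continuous_iff_continuousAt.2 fun t => (hf t).continuousAt
  have cz : Continuous z := continuous_iff_continuousAt.2 fun t => (hz t).continuousAt
  have hσ0 : Tendsto (fun p : ℕ × ℝ => p.2) smallNoise (𝓝 0) :=
    tendsto_snd_smallNoise.mono_right nhdsWithin_le_nhds
  have hRS : ∀ g : ℝ → ℝ, Continuous g → Tendsto (fun p : ℕ × ℝ =>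
      1 / (p.1 : ℝ) * ∑ i ∈ Finset.range p.1, g ((i : ℝ) / p.1)) smallNoise
      (𝓝 (∫ u in (0 : ℝ)..1, g u)) := fun g hg => (tendsto_riemannSum hg).comp tendsto_fst_smallNoise
  have hA : Tendsto (fun p : ℕ × ℝ => 1 / (p.1 : ℝ) * ∑ i ∈ Finset.range p.1,
      (f ((i : ℝ) / p.1) + p.2 * (s ((i : ℝ) / p.1) + z ((i : ℝ) / p.1)))) smallNoise
      (𝓝 (∫ u in (0 : ℝ)..1, f u)) := by
    have h := (hRS f cf).add (hσ0.mul (hRS (fun t => s t + z t) (by fun_prop)))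
    rw [zero_mul, add_zero] at h
    refine h.congr fun p => ?_
    simp only [Finset.mul_sum, ← Finset.sum_add_distrib]
    exact Finset.sum_congr rfl fun i _ => by ring
  have hB : Tendsto (fun p : ℕ × ℝ => 1 / (p.1 : ℝ) * ∑ i ∈ Finset.range p.1,
      (f ((i : ℝ) / p.1) + p.2 * (s ((i : ℝ) / p.1) + z ((i : ℝ) / p.1))) ^ 2) smallNoise
      (𝓝 (∫ u in (0 : ℝ)..1, f u ^ 2)) := by
    have h := ((hRS (fun t => f t ^ 2) (by fun_prop)).add
      (hσ0.mul (hRS (fun t => 2 * f t * (s t + z t)) (by fun_prop)))).add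
      ((hσ0.pow 2).mul (hRS (fun t => (s t + z t) ^ 2) (by fun_prop)))
    simp only [zero_mul, add_zero, ne_eq, OfNat.ofNat_ne_zero, not_false_eq_true, zero_pow] at h
    refine h.congr fun p => ?_
    simp only [Finset.mul_sum, ← Finset.sum_add_distrib]
    exact Finset.sum_congr rfl fun i _ => by ring
  have hD := hB.sub (hA.pow 2)
  have hDpos := sub_pos.2 (sq_integral_lt_integral_sq cf hf01)
  obtain ⟨Mf, hMf⟩ := isCompact_Icc.exists_bound_of_continuousOn (s := Set.Icc (0 : ℝ) 1)
    cf.continuousOn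
  obtain ⟨My, hMy⟩ := isCompact_Icc.exists_bound_of_continuousOn (s := Set.Icc (0 : ℝ) 1)
    (hs.add cz).continuousOn
  have hbd : ∀ᶠ p : ℕ × ℝ in smallNoise, ∀ i < p.1,
      |f ((i : ℝ) / p.1) + p.2 * (s ((i : ℝ) / p.1) + z ((i : ℝ) / p.1))| ≤ Mf + My := by
    filter_upwards [eventually_pos_smallNoise, hσ0.eventually_le_const zero_lt_one] with p hp h1 i hi
    refine (abs_add_le _ _).trans (add_le_add (hMf _ (grid_mem_Icc hi)) ?_)
    rw [abs_mul, abs_of_pos hp.2]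
    exact (mul_le_of_le_one_left (abs_nonneg _) h1).trans (hMy _ (grid_mem_Icc hi))
  have hV : Tendsto (fun p : ℕ × ℝ => p.2⁻¹ * ∑ i ∈ Finset.range p.1,
      eulerResidual μ θ p.1 (fun t => f t + p.2 * (s t + z t)) i) smallNoise (𝓝 (s 1)) := by
    have h := tendsto_sum_eulerResidual_sub hf hs hz (w := fun _ _ => 1) (M := 1)
      (Eventually.of_forall fun p i _ => by simp)
    have h2 := h.add_const (s 1)
    rw [zero_add] at h2
    refine h2.congr' ?_
    filter_upwards [eventually_pos_smallNoise] with p hp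
    have hn0 : (p.1 : ℝ) ≠ 0 := by exact_mod_cast hp.1.ne'
    have h := Finset.sum_range_sub (fun i : ℕ => s ((i : ℝ) / p.1)) p.1
    simp only [Nat.cast_add, Nat.cast_one, Nat.cast_zero, zero_div, div_self hn0, hs0] at h
    simp only [mul_one, h]
    ring
  have hU : Tendsto (fun p : ℕ × ℝ => p.2⁻¹ * ∑ i ∈ Finset.range p.1,
      eulerResidual μ θ p.1 (fun t => f t + p.2 * (s t + z t)) i
        * (f ((i : ℝ) / p.1) + p.2 * (s ((i : ℝ) / p.1) + z ((i : ℝ) / p.1)))) smallNoise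
      (𝓝 J) := by
    have h := tendsto_sum_eulerResidual_sub hf hs hz hbd
    have h1 := hJ.tendsto_sum_grid.comp tendsto_fst_smallNoise
    have h2 := (hasRSIntegral_of_hasDerivAt (a := 0) (b := 1) hz (by fun_prop)
      hs.continuousOn).tendsto_sum_grid.comp tendsto_fst_smallNoise
    have h3 := hQ.comp tendsto_fst_smallNoise
    have h4 := (h.add h1).add
      (hσ0.mul (h2.add (((tendsto_const_nhds (x := s 1 ^ 2 - s 0 ^ 2)).sub h3).div_const 2)))
    rw [zero_add, zero_mul, add_zero] at h4
    refine h4.congr' ?_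
    filter_upwards [eventually_pos_smallNoise] with p hp
    simp only [Function.comp_apply]
    rw [← sum_increment_mul_self s hp.1.ne', ← Finset.sum_add_distrib, sub_add,
      sub_add, sub_eq_self, Finset.mul_sum, ← Finset.sum_sub_distrib, ← Finset.sum_sub_distrib]
    exact Finset.sum_eq_zero fun i _ => by ring
  have hev : ∀ᶠ p : ℕ × ℝ in smallNoise, p.1 ≠ 0 ∧
      gridVariance p.1 (fun t => f t + p.2 * (s t + z t)) ≠ 0 := by
    filter_upwards [eventually_pos_smallNoise, hD.eventually_ne hDpos.ne'] with p hp h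
    exact ⟨hp.1.ne', h⟩
  constructor
  · refine ((hU.sub (hA.mul hV)).div hD hDpos.ne').congr' ?_
    filter_upwards [hev] with p hp
    rw [lseTheta_sub_eq μ θ hp.1 hp.2, gridVariance, Pi.div_apply, ← mul_div_assoc]
    congr 1
    ring
  · refine (((hB.mul hV).sub (hA.mul hU)).div hD hDpos.ne').congr' ?_
    filter_upwards [hev] with p hp
    rw [lseMu_sub_eq μ θ hp.1 hp.2, gridVariance, Pi.div_apply, ← mul_div_assoc]
    congr 1
    ring

/-! ### Solutions of the equation -/

theorem noiselessPath_eq (x₀ μ θ t : ℝ) :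
    μ + θ * noiselessPath x₀ μ θ t = (μ + θ * x₀) * Real.exp (θ * t) := by
  unfold noiselessPath
  split_ifs with h
  · simp [h]
  · field_simp; ring

theorem noiselessPath_zero (x₀ μ θ : ℝ) : noiselessPath x₀ μ θ 0 = x₀ := by
  unfold noiselessPath
  split_ifs <;> simp

theorem hasDerivAt_noiselessPath (x₀ μ θ t : ℝ) :
    HasDerivAt (noiselessPath x₀ μ θ) (μ + θ * noiselessPath x₀ μ θ t) t := by
  rw [noiselessPath_eq]
  have he : HasDerivAt (fun t => Real.exp (θ * t)) (Real.exp (θ * t) * (θ * 1)) t :=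
    ((hasDerivAt_id t).const_mul θ).exp
  by_cases h : θ = 0
  · have : noiselessPath x₀ μ θ = fun t => x₀ + μ * t := by
      funext t; simp [noiselessPath, h]
    rw [this, h]
    simpa using ((hasDerivAt_id t).const_mul μ).const_add x₀
  · have : noiselessPath x₀ μ θ
        = fun t => μ / θ * (Real.exp (θ * t) - 1) + x₀ * Real.exp (θ * t) := by
      funext t; simp [noiselessPath, h]
    rw [this]
    refine (((he.sub_const 1).const_mul (μ / θ)).add (he.const_mul x₀)).congr_deriv ?_
    field_simp

theorem noiselessPath_zero_ne_one {x₀ μ θ : ℝ} (h : μ + θ * x₀ ≠ 0) :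
    noiselessPath x₀ μ θ 0 ≠ noiselessPath x₀ μ θ 1 := by
  intro heq
  by_cases hθ : θ = 0
  · simp only [noiselessPath, hθ, if_true] at heq
    apply h; rw [hθ]; linarith
  · have h0 := noiselessPath_eq x₀ μ θ 0
    have h1 := noiselessPath_eq x₀ μ θ 1
    rw [← heq, h0] at h1
    have := mul_left_cancel₀ h h1
    rw [Real.exp_eq_exp] at this
    simp at this
    exact hθ this.symm

/-- The convolution `t ↦ θ ∫_0^t e^{θ (t - u)} s u du`, which is the solution of `z' = θ (s + z)`,
`z 0 = 0`. -/
noncomputable def driftResponse (θ : ℝ) (s : ℝ → ℝ) (t : ℝ) : ℝ :=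
  θ * (Real.exp (θ * t) * ∫ u in (0 : ℝ)..t, Real.exp (-(θ * u)) * s u)

theorem hasDerivAt_driftResponse (θ : ℝ) {s : ℝ → ℝ} (hs : Continuous s) (t : ℝ) :
    HasDerivAt (driftResponse θ s) (θ * (s t + driftResponse θ s t)) t := by
  have he : HasDerivAt (fun t => Real.exp (θ * t)) (Real.exp (θ * t) * (θ * 1)) t :=
    ((hasDerivAt_id t).const_mul θ).exp
  have hi : HasDerivAt (fun t => ∫ u in (0 : ℝ)..t, Real.exp (-(θ * u)) * s u)
      (Real.exp (-(θ * t)) * s t) t :=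
    intervalIntegral.integral_hasDerivAt_right
      (by apply Continuous.intervalIntegrable; fun_prop)
      (Continuous.stronglyMeasurableAtFilter (by fun_prop) _ _) (by fun_prop)
  refine ((he.mul hi).const_mul θ).congr_deriv ?_
  unfold driftResponse
  have : Real.exp (θ * t) * Real.exp (-(θ * t)) = 1 := by rw [← Real.exp_add]; simp
  linear_combination θ * s t * this

/-- A solution depends on `σ` affinely, by variation of constants. -/
theorem IsVasicekPath.eq_noiselessPath_add {x₀ μ θ σ : ℝ} {s x : ℝ → ℝ} (hs : Continuous s)
    (h : IsVasicekPath x₀ μ θ σ s x) {t : ℝ} (ht : 0 ≤ t) :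
    x t = noiselessPath x₀ μ θ t + σ * (s t + driftResponse θ s t) := by
  set x' : ℝ → ℝ := fun t => x (max t 0) with hx'
  have cx' : Continuous x' := h.cont.comp_continuous (by fun_prop) (fun t => Set.mem_Ici.2 (le_max_right _ _))
  have hxe : ∀ t, 0 ≤ t → x' t = x t := fun t ht => by simp [hx', ht]
  set A : ℝ → ℝ := fun t => ∫ u in (0 : ℝ)..t, (μ + θ * x' u) with hA
  have hAd : ∀ t, HasDerivAt A (μ + θ * x' t) t := fun t =>
    intervalIntegral.integral_hasDerivAt_right
      (by apply Continuous.intervalIntegrable; fun_prop)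
      (Continuous.stronglyMeasurableAtFilter (by fun_prop) _ _) (by fun_prop)
  have hAx : ∀ t, 0 ≤ t → x t = x₀ + A t + σ * s t := by
    intro t ht
    rw [h.eqn t ht]
    congr 2
    refine intervalIntegral.integral_congr fun u hu => ?_
    rw [Set.uIcc_of_le ht] at hu
    simp only [hxe u hu.1]
  -- `G` is the error of the formula multiplied by the integrating factor `e^{-θ t}`.
  set G : ℝ → ℝ := fun t => Real.exp (-(θ * t))
    * (x₀ + A t - noiselessPath x₀ μ θ t - σ * driftResponse θ s t) with hG
  have hGd : ∀ u ∈ Set.uIcc 0 t, HasDerivAt G 0 u := by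
    intro u hu
    rw [Set.uIcc_of_le ht] at hu
    have he : HasDerivAt (fun t => Real.exp (-(θ * t))) (Real.exp (-(θ * u)) * (-(θ * 1))) u :=
      ((hasDerivAt_id u).const_mul θ).neg.exp
    refine (he.mul ((((hAd u).const_add x₀).sub (hasDerivAt_noiselessPath x₀ μ θ u)).sub
      ((hasDerivAt_driftResponse θ hs u).const_mul σ))).congr_deriv ?_
    rw [hxe u hu.1, hAx u hu.1]
    simp only [Pi.sub_apply]
    ring
  have hint := intervalIntegral.integral_eq_sub_of_hasDerivAt hGd (by simp)
  have hG0 : G 0 = 0 := by simp [hG, hA, driftResponse, noiselessPath_zero]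
  rw [hG0, intervalIntegral.integral_zero, sub_zero] at hint
  have := (mul_eq_zero.1 hint.symm).resolve_left (Real.exp_pos _).ne'
  rw [hAx t ht]
  linarith

/-! ### Quadratic variation of sub-fractional Brownian motion -/

theorem integral_pow_gaussianReal (v : NNReal) (p : ℕ) :
    ∫ x, x ^ (2 * p) ∂gaussianReal 0 v
      = (v : ℝ) ^ p * ∫ x, x ^ (2 * p) ∂gaussianReal 0 1 := by
  have h : (gaussianReal 0 1).map (Real.sqrt v * ·) = gaussianReal 0 v := by
    rw [gaussianReal_map_const_mul, mul_zero, mul_one]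
    congr 1
    ext
    simp
  rw [← h, integral_map (by fun_prop) (by fun_prop), ← integral_const_mul]
  refine integral_congr_ae (Eventually.of_forall fun x => ?_)
  simp only [mul_pow, pow_mul, Real.sq_sqrt v.coe_nonneg]

theorem ProbabilityTheory.HasGaussianLaw.integral_pow_eq {Ω : Type*} [MeasurableSpace Ω]
    {P : Measure Ω} {X : Ω → ℝ} (hX : HasGaussianLaw X P) (h0 : ∫ ω, X ω ∂P = 0) (p : ℕ) :
    ∫ ω, X ω ^ (2 * p) ∂P
      = (∫ ω, X ω ^ 2 ∂P) ^ p * ∫ x, x ^ (2 * p) ∂gaussianReal 0 1 := by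
  have hm := hX.map_eq_gaussianReal
  have hvar := variance_of_integral_eq_zero hX.aemeasurable h0
  rw [h0, hvar] at hm
  have := integral_map hX.aemeasurable (f := fun x : ℝ => x ^ (2 * p)) (by fun_prop)
  rw [← this, hm, integral_pow_gaussianReal]
  rw [Real.coe_toNNReal _ (integral_nonneg fun ω => sq_nonneg _)]

theorem ae_tendsto_zero_of_summable_integral {Ω : Type*} [MeasurableSpace Ω] {P : Measure Ω}
    {T : ℕ → Ω → ℝ} (hT0 : ∀ n ω, 0 ≤ T n ω) (hT : ∀ n, Integrable (T n) P)
    (hsum : Summable fun n => ∫ ω, T n ω ∂P) :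
    ∀ᵐ ω ∂P, Tendsto (fun n => T n ω) atTop (𝓝 0) := by
  have hm : ∀ n, AEMeasurable (fun ω => ENNReal.ofReal (T n ω)) P := fun n =>
    (hT n).aemeasurable.ennreal_ofReal
  have hfin : ∫⁻ ω, ∑' n, ENNReal.ofReal (T n ω) ∂P ≠ ⊤ := by
    rw [lintegral_tsum hm]
    have : ∀ n, ∫⁻ ω, ENNReal.ofReal (T n ω) ∂P = ENNReal.ofReal (∫ ω, T n ω ∂P) := fun n =>
      (ofReal_integral_eq_lintegral_ofReal (hT n) (Eventually.of_forall (hT0 n))).symm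
    simp_rw [this]
    rw [← ENNReal.ofReal_tsum_of_nonneg (fun n => integral_nonneg (hT0 n)) hsum]
    exact ENNReal.ofReal_ne_top
  filter_upwards [ae_lt_top' (AEMeasurable.tsum hm) hfin] with ω hω
  have h := ENNReal.tendsto_atTop_zero_of_tsum_ne_top hω.ne
  have h2 := (ENNReal.tendsto_toReal ENNReal.zero_ne_top).comp h
  refine h2.congr fun n => ?_
  simp [hT0]

namespace IsSubFBm

variable {Ω : Type*} [MeasurableSpace Ω] {P : Measure Ω} {H : ℝ} {S : ℝ → Ω → ℝ}

theorem hasGaussianLaw (hS : IsSubFBm H S P) {t : ℝ} (ht : 0 ≤ t) : HasGaussianLaw (S t) P :=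
  hS.gaussian.hasGaussianLaw_eval ⟨t, ht⟩

theorem hasGaussianLaw_sub (hS : IsSubFBm H S P) {s t : ℝ} (hs : 0 ≤ s) (ht : 0 ≤ t) :
    HasGaussianLaw (fun ω => S t ω - S s ω) P :=
  hS.gaussian.hasGaussianLaw_fun_sub (s := ⟨t, ht⟩) (t := ⟨s, hs⟩)

theorem integral_sub (hS : IsSubFBm H S P) {s t : ℝ} (hs : 0 ≤ s) (ht : 0 ≤ t) :
    ∫ ω, (S t ω - S s ω) ∂P = 0 := by
  have := (hS.hasGaussianLaw hs).isProbabilityMeasure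
  rw [MeasureTheory.integral_sub (hS.hasGaussianLaw ht).integrable (hS.hasGaussianLaw hs).integrable,
    hS.mean t ht, hS.mean s hs, sub_zero]

/-- The increments of sub-fractional Brownian motion are no larger in mean square than those of
fractional Brownian motion; this is convexity of `r ↦ r ^ (2 H)`. -/
theorem integral_sub_sq_le (hS : IsSubFBm H S P) (hH : 1 / 2 < H) {s t : ℝ} (hs : 0 ≤ s)
    (hst : s ≤ t) : ∫ ω, (S t ω - S s ω) ^ 2 ∂P ≤ (t - s) ^ (2 * H) := by
  have ht : 0 ≤ t := hs.trans hst
  have h2H : 1 ≤ 2 * H := by linarith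
  have ms := (hS.hasGaussianLaw hs).memLp_two
  have mt := (hS.hasGaussianLaw ht).memLp_two
  have hexp : ∫ ω, (S t ω - S s ω) ^ 2 ∂P = (∫ ω, S t ω * S t ω ∂P) + (∫ ω, S s ω * S s ω ∂P)
      - 2 * ∫ ω, S t ω * S s ω ∂P := by
    have itt : Integrable (fun ω => S t ω * S t ω) P := mt.integrable_mul mt
    have iss : Integrable (fun ω => S s ω * S s ω) P := ms.integrable_mul ms
    have its : Integrable (fun ω => S t ω * S s ω) P := mt.integrable_mul ms
    rw [← integral_const_mul, ← integral_add itt iss,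
      ← MeasureTheory.integral_sub (f := fun ω => S t ω * S t ω + S s ω * S s ω)
        (itt.add iss) (its.const_mul 2)]
    exact integral_congr_ae (Eventually.of_forall fun ω => by ring)
  rw [hexp, hS.cov t t ht ht, hS.cov s s hs hs, hS.cov s t hs ht, sub_self, sub_self, abs_zero,
    Real.zero_rpow (by linarith), abs_sub_comm, abs_of_nonneg (sub_nonneg.2 hst)]
  have e : ∀ r : ℝ, 0 ≤ r → (r + r) ^ (2 * H) = 2 ^ (2 * H) * r ^ (2 * H) := fun r hr => by
    rw [← two_mul, Real.mul_rpow (by norm_num) hr]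
  rw [e t ht, e s hs]
  -- convexity of `r ↦ r ^ (2 H)` at the midpoint of `s` and `t`
  have hconv := (convexOn_rpow h2H).2 (Set.mem_Ici.2 hs) (Set.mem_Ici.2 ht)
    (by norm_num : (0 : ℝ) ≤ 1 / 2) (by norm_num : (0 : ℝ) ≤ 1 / 2) (by norm_num)
  simp only [smul_eq_mul] at hconv
  rw [← mul_add, Real.mul_rpow (by norm_num) (by linarith),
    Real.div_rpow (by norm_num) (by norm_num), Real.one_rpow] at hconv
  have h2 : (0 : ℝ) < 2 ^ (2 * H) := by positivity
  have : (s + t) ^ (2 * H) ≤ 2 ^ (2 * H) * (1 / 2 * (s ^ (2 * H) + t ^ (2 * H))) := by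
    rw [div_mul_eq_mul_div, one_mul, div_le_iff₀ h2] at hconv
    linarith
  linarith

/-- The quadratic variation along the uniform grids of `[0, 1]` vanishes almost surely, as a single
event for all grid sizes. A moment of high order, computed from the Gaussian law of the increments,
makes the expectations summable, so no Hölder continuity of the paths is needed. -/
theorem ae_tendsto_quadraticVariation (hS : IsSubFBm H S P) (hH : 1 / 2 < H) :
    ∀ᵐ ω ∂P, Tendsto (fun n : ℕ => ∑ i ∈ Finset.range n,
      (S ((i + 1 : ℝ) / n) ω - S ((i : ℝ) / n) ω) ^ 2) atTop (𝓝 0) := by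
  -- With `(2 H - 1) (p + 1) > 1` the `(p + 1)`-th moments of the sums are summable in `n`.
  obtain ⟨p, hp⟩ := exists_nat_gt (1 / (2 * H - 1))
  have hp' : 1 < (2 * H - 1) * ((p : ℝ) + 1) := by
    rw [div_lt_iff₀ (by linarith)] at hp
    nlinarith
  set C := ∫ x, x ^ (2 * (p + 1)) ∂gaussianReal 0 1 with hC
  have hC0 : 0 ≤ C := integral_nonneg fun x => by
    rw [pow_mul]; positivity
  -- By Jensen's inequality `T n` bounds the `(p + 1)`-th power of the sum of squares.
  set T : ℕ → Ω → ℝ := fun n ω => (n : ℝ) ^ p * ∑ i ∈ Finset.range n,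
    (S ((i + 1 : ℝ) / n) ω - S ((i : ℝ) / n) ω) ^ (2 * (p + 1)) with hT
  have hgrid : ∀ n i : ℕ, 0 ≤ (i : ℝ) / n ∧ 0 ≤ (i + 1 : ℝ) / n := fun n i =>
    ⟨by positivity, by positivity⟩
  have hint : ∀ n i : ℕ, Integrable
      (fun ω => (S ((i + 1 : ℝ) / n) ω - S ((i : ℝ) / n) ω) ^ (2 * (p + 1))) P := fun n i => by
    have h := ((hS.hasGaussianLaw_sub (hgrid n i).1 (hgrid n i).2).memLp
      (ENNReal.natCast_ne_top (2 * (p + 1)))).integrable_norm_pow (by omega)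
    refine h.congr (Eventually.of_forall fun ω => ?_)
    simp [pow_mul]
  have hT0 : ∀ n ω, 0 ≤ T n ω := fun n ω => by
    simp only [hT, pow_mul]; positivity
  have hTint : ∀ n, Integrable (T n) P := fun n =>
    (integrable_finsetSum _ fun i _ => hint n i).const_mul _
  have hTle : ∀ n : ℕ, ∫ ω, T n ω ∂P ≤ C * (n : ℝ) ^ (-((2 * H - 1) * ((p : ℝ) + 1))) := by
    intro n
    rcases Nat.eq_zero_or_pos n with rfl | hn
    · simp [hT]; positivity
    have hn0 : (0 : ℝ) < n := by exact_mod_cast hn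
    simp only [hT]
    rw [integral_const_mul, integral_finsetSum _ fun i _ => hint n i]
    have hle : ∀ i ∈ Finset.range n,
        ∫ ω, (S ((i + 1 : ℝ) / n) ω - S ((i : ℝ) / n) ω) ^ (2 * (p + 1)) ∂P
          ≤ ((1 / (n : ℝ)) ^ (2 * H)) ^ (p + 1) * C := by
      intro i _
      rw [(hS.hasGaussianLaw_sub (hgrid n i).1 (hgrid n i).2).integral_pow_eq
        (hS.integral_sub (hgrid n i).1 (hgrid n i).2)]
      refine mul_le_mul_of_nonneg_right (pow_le_pow_left₀ (integral_nonneg fun ω => sq_nonneg _)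
        ?_ _) hC0
      have := hS.integral_sub_sq_le hH (hgrid n i).1 (t := (i + 1 : ℝ) / n) (by gcongr; linarith)
      rwa [← sub_div, add_sub_cancel_left] at this
    refine (mul_le_mul_of_nonneg_left (Finset.sum_le_sum hle) (by positivity)).trans (le_of_eq ?_)
    rw [Finset.sum_const, Finset.card_range, nsmul_eq_mul, one_div, Real.inv_rpow hn0.le,
      ← Real.rpow_neg hn0.le, ← Real.rpow_mul_natCast hn0.le]
    have : -((2 * H - 1) * ((p : ℝ) + 1))
        = ((p + 1 : ℕ) : ℝ) + -(2 * H) * ((p + 1 : ℕ) : ℝ) := by push_cast; ring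
    rw [this, Real.rpow_add hn0, Real.rpow_natCast]
    ring
  have hsum : Summable fun n => ∫ ω, T n ω ∂P :=
    Summable.of_nonneg_of_le (fun n => integral_nonneg (hT0 n)) hTle
      ((Real.summable_nat_rpow.2 (by linarith)).mul_left C)
  filter_upwards [ae_tendsto_zero_of_summable_integral hT0 hTint hsum] with ω hω
  have hpow : Tendsto (fun n : ℕ => (∑ i ∈ Finset.range n,
      (S ((i + 1 : ℝ) / n) ω - S ((i : ℝ) / n) ω) ^ 2) ^ (p + 1)) atTop (𝓝 0) := by
    refine squeeze_zero (fun n => by positivity) (fun n => ?_) hω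
    have h := pow_sum_le_card_mul_sum_pow (s := Finset.range n)
      (f := fun i : ℕ => (S ((i + 1 : ℝ) / n) ω - S ((i : ℝ) / n) ω) ^ 2)
      (fun i _ => sq_nonneg _) p
    simpa [hT, ← pow_mul] using h
  have h := hpow.rpow_const (p := ((p + 1 : ℕ) : ℝ)⁻¹) (Or.inr (by positivity))
  rw [Real.zero_rpow (by positivity)] at h
  exact h.congr fun n => Real.pow_rpow_inv_natCast (Finset.sum_nonneg fun i _ => sq_nonneg _)
    (Nat.succ_ne_zero p)

end IsSubFBm

/-! ### The estimators along solutions -/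

theorem lseTheta_congr {x y : ℝ → ℝ} (h : Set.EqOn x y (Set.Ici 0)) (n : ℕ) :
    lseTheta n x = lseTheta n y := by
  have h0 : ∀ i : ℕ, x ((i : ℝ) / n) = y ((i : ℝ) / n) := fun i => h (Set.mem_Ici.2 (by positivity))
  have h1 : ∀ i : ℕ, x ((i + 1 : ℝ) / n) = y ((i + 1 : ℝ) / n) := fun i =>
    h (Set.mem_Ici.2 (by positivity))
  simp only [lseTheta, h0, h1]

theorem lseMu_congr {x y : ℝ → ℝ} (h : Set.EqOn x y (Set.Ici 0)) (n : ℕ) :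
    lseMu n x = lseMu n y := by
  have h0 : ∀ i : ℕ, x ((i : ℝ) / n) = y ((i : ℝ) / n) := fun i => h (Set.mem_Ici.2 (by positivity))
  have h1 : ∀ i : ℕ, x ((i + 1 : ℝ) / n) = y ((i + 1 : ℝ) / n) := fun i =>
    h (Set.mem_Ici.2 (by positivity))
  simp only [lseMu, h0, h1]

theorem aemeasurable_lse {Ω : Type*} [MeasurableSpace Ω] {P : Measure Ω} {X : ℝ → Ω → ℝ}
    (hX : ∀ t : ℝ, 0 ≤ t → AEMeasurable (X t) P) (n : ℕ) :
    AEMeasurable (fun ω => lseTheta n (fun t => X t ω)) P ∧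
      AEMeasurable (fun ω => lseMu n (fun t => X t ω)) P := by
  have h0 : ∀ i : ℕ, AEMeasurable (fun ω => X ((i : ℝ) / n) ω) P := fun i => hX _ (by positivity)
  have h1 : ∀ i : ℕ, AEMeasurable (fun ω => X ((i + 1 : ℝ) / n) ω) P := fun i =>
    hX _ (by positivity)
  unfold lseTheta lseMu
  constructor <;> fun_prop

/-- The value, found by integration by parts, of the Riemann–Stieltjes integral over `[0, 1]` of the
noiseless solution against the path `s`. -/
noncomputable def noiselessIntegral (x₀ μ θ : ℝ) (s : ℝ → ℝ) : ℝ :=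
  noiselessPath x₀ μ θ 1 * s 1 - noiselessPath x₀ μ θ 0 * s 0
    - ∫ t in (0 : ℝ)..1, s t * (μ + θ * noiselessPath x₀ μ θ t)

theorem continuous_noiselessPath (x₀ μ θ : ℝ) : Continuous (noiselessPath x₀ μ θ) :=
  continuous_iff_continuousAt.2 fun t => (hasDerivAt_noiselessPath x₀ μ θ t).continuousAt

theorem hasRSIntegral_noiselessPath (x₀ μ θ : ℝ) {s : ℝ → ℝ} (hs : ContinuousOn s (Set.Ici 0)) :
    HasRSIntegral (noiselessPath x₀ μ θ) s 0 1 (noiselessIntegral x₀ μ θ s) :=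
  hasRSIntegral_of_hasDerivAt (hasDerivAt_noiselessPath x₀ μ θ)
    (by have := continuous_noiselessPath x₀ μ θ; fun_prop) (hs.mono Set.Icc_subset_Ici_self)

/-- The pathwise limit theorem. The index filter `l` covers both sequences `(n k, σ k)` and the whole
filter `smallNoise`. -/
theorem tendsto_lse_of_isVasicekPath {x₀ μ θ : ℝ} (hnd : μ + θ * x₀ ≠ 0) {s : ℝ → ℝ}
    (hs : ContinuousOn s (Set.Ici 0)) (hs0 : s 0 = 0)
    (hQ : Tendsto (fun n : ℕ => ∑ i ∈ Finset.range n,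
      (s ((i + 1 : ℝ) / n) - s ((i : ℝ) / n)) ^ 2) atTop (𝓝 0))
    {ι : Type*} {l : Filter ι} {n : ι → ℕ} {σ : ι → ℝ} {x : ι → ℝ → ℝ}
    (hnσ : Tendsto (fun k => (n k, σ k)) l smallNoise)
    (hx : ∀ᶠ k in l, IsVasicekPath x₀ μ θ (σ k) s (x k)) :
    Tendsto (fun k => (σ k)⁻¹ * (lseTheta (n k) (x k) - θ)) l
        (𝓝 (thetaLimit x₀ μ θ (noiselessIntegral x₀ μ θ s) (s 1))) ∧
      Tendsto (fun k => (σ k)⁻¹ * (lseMu (n k) (x k) - μ)) l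
        (𝓝 (muLimit x₀ μ θ (noiselessIntegral x₀ μ θ s) (s 1))) := by
  -- Extending `s` by a constant to the left of `0` makes it continuous on `ℝ`.
  set r : ℝ → ℝ := fun t => s (max t 0) with hr
  have cr : Continuous r := hs.comp_continuous (by fun_prop) fun t => Set.mem_Ici.2 (le_max_right _ _)
  have hrs : ∀ t, 0 ≤ t → r t = s t := fun t ht => by simp [hr, ht]
  have hQr : Tendsto (fun n : ℕ => ∑ i ∈ Finset.range n,
      (r ((i + 1 : ℝ) / n) - r ((i : ℝ) / n)) ^ 2) atTop (𝓝 0) := by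
    refine hQ.congr fun n => Finset.sum_congr rfl fun i _ => ?_
    rw [hrs _ (by positivity), hrs _ (by positivity)]
  have hJ : noiselessIntegral x₀ μ θ r = noiselessIntegral x₀ μ θ s := by
    unfold noiselessIntegral
    rw [hrs 0 le_rfl, hrs 1 zero_le_one]
    congr 1
    refine intervalIntegral.integral_congr fun t ht => ?_
    rw [Set.uIcc_of_le zero_le_one] at ht
    simp only [hrs t ht.1]
  have hpath : ∀ᶠ k in l, Set.EqOn
      (fun t => noiselessPath x₀ μ θ t + σ k * (r t + driftResponse θ r t)) (x k) (Set.Ici 0) := by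
    filter_upwards [hx] with k hk t ht
    have hk' : IsVasicekPath x₀ μ θ (σ k) r (x k) :=
      ⟨hk.cont, fun t ht => by rw [hrs t ht]; exact hk.eqn t ht⟩
    exact (hk'.eq_noiselessPath_add cr ht).symm
  have h := tendsto_lse (hasDerivAt_noiselessPath x₀ μ θ) (noiselessPath_zero_ne_one hnd) cr
    (by rw [hrs 0 le_rfl, hs0]) (hasDerivAt_driftResponse θ cr) hQr
    (hasRSIntegral_noiselessPath x₀ μ θ cr.continuousOn)
  rw [hJ, hrs 1 zero_le_one] at h
  refine ⟨(h.1.comp hnσ).congr' ?_, (h.2.comp hnσ).congr' ?_⟩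
  · filter_upwards [hpath] with k hk
    simp only [Function.comp_apply, lseTheta_congr hk]
  · filter_upwards [hpath] with k hk
    simp only [Function.comp_apply, lseMu_congr hk]

/-- Measurability comes from the approximating sums, since `S` is not assumed jointly measurable. -/
theorem IsSubFBm.aemeasurable_noiselessIntegral {Ω : Type*} [MeasurableSpace Ω] {P : Measure Ω}
    {H : ℝ} {S : ℝ → Ω → ℝ} (hS : IsSubFBm H S P) (x₀ μ θ : ℝ) :
    AEMeasurable (fun ω => noiselessIntegral x₀ μ θ fun t => S t ω) P := by
  refine aemeasurable_of_tendsto_metrizable_ae atTop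
    (f := fun (n : ℕ) ω => ∑ i ∈ Finset.range n, noiselessPath x₀ μ θ ((i : ℝ) / n)
      * (S ((i + 1 : ℝ) / n) ω - S ((i : ℝ) / n) ω)) (fun n => ?_) ?_
  · exact Finset.aemeasurable_fun_sum _ fun i _ => (hS.hasGaussianLaw_sub (by positivity)
      (by positivity)).aemeasurable.const_mul _
  · filter_upwards [hS.cont] with ω hω
    exact (hasRSIntegral_noiselessPath x₀ μ θ hω).tendsto_sum_grid

theorem theorem4p2 {Ω : Type*} [MeasurableSpace Ω] (P : Measure Ω) [IsProbabilityMeasure P]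
    (H : ℝ) (hH : 1 / 2 < H) (hH1 : H < 1)
    (S : ℝ → Ω → ℝ) (hS : IsSubFBm H S P)
    (x₀ μ₀ θ₀ : ℝ) (hnd : μ₀ + θ₀ * x₀ ≠ 0)
    -- `X σ` is the solution with noise level `σ > 0`
    (X : ℝ → ℝ → Ω → ℝ)
    (hXm : ∀ σ > 0, ∀ t : ℝ, 0 ≤ t → AEMeasurable (X σ t) P)
    (hX : ∀ σ > 0, ∀ᵐ ω ∂P,
      IsVasicekPath x₀ μ₀ θ₀ σ (fun t => S t ω) (fun t => X σ t ω)) :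
    -- `J` is the integral `∫_0^1 X⁰ dS`
    ∃ J : Ω → ℝ, AEMeasurable J P ∧
      (∀ᵐ ω ∂P, HasRSIntegral (noiselessPath x₀ μ₀ θ₀) (fun t => S t ω) 0 1 (J ω)) ∧
      -- almost sure convergence and joint convergence in distribution along sequences
      (∀ (n : ℕ → ℕ) (σ : ℕ → ℝ), (∀ k, 0 < σ k) →
        Tendsto n atTop atTop → Tendsto σ atTop (𝓝 0) →
        Tendsto (fun k => (n k : ℝ) * σ k) atTop atTop →
        (∀ᵐ ω ∂P,
          Tendsto (fun k => (σ k)⁻¹ * (lseTheta (n k) (fun t => X (σ k) t ω) - θ₀)) atTop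
            (𝓝 (thetaLimit x₀ μ₀ θ₀ (J ω) (S 1 ω))) ∧
          Tendsto (fun k => (σ k)⁻¹ * (lseMu (n k) (fun t => X (σ k) t ω) - μ₀)) atTop
            (𝓝 (muLimit x₀ μ₀ θ₀ (J ω) (S 1 ω)))) ∧
        TendstoInDistribution
          (fun (k : ℕ) (ω : Ω) =>
            ((σ k)⁻¹ * (lseTheta (n k) (fun t => X (σ k) t ω) - θ₀),
              (σ k)⁻¹ * (lseMu (n k) (fun t => X (σ k) t ω) - μ₀)))
          atTop
          (fun ω => (thetaLimit x₀ μ₀ θ₀ (J ω) (S 1 ω), muLimit x₀ μ₀ θ₀ (J ω) (S 1 ω)))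
          (fun _ => P) P) ∧
      -- if one null set serves all `σ` in the equation, one null set serves the whole limit
      ((∀ᵐ ω ∂P, ∀ σ > 0,
          IsVasicekPath x₀ μ₀ θ₀ σ (fun t => S t ω) (fun t => X σ t ω)) →
        ∀ᵐ ω ∂P,
          Tendsto (fun p : ℕ × ℝ => p.2⁻¹ * (lseTheta p.1 (fun t => X p.2 t ω) - θ₀)) smallNoise
            (𝓝 (thetaLimit x₀ μ₀ θ₀ (J ω) (S 1 ω))) ∧
          Tendsto (fun p : ℕ × ℝ => p.2⁻¹ * (lseMu p.1 (fun t => X p.2 t ω) - μ₀)) smallNoise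
            (𝓝 (muLimit x₀ μ₀ θ₀ (J ω) (S 1 ω)))) := by
  have hJm := hS.aemeasurable_noiselessIntegral x₀ μ₀ θ₀
  have hS1 := (hS.hasGaussianLaw zero_le_one).aemeasurable
  have hQ := hS.ae_tendsto_quadraticVariation hH
  refine ⟨fun ω => noiselessIntegral x₀ μ₀ θ₀ fun t => S t ω, hJm, ?_, ?_, ?_⟩
  · filter_upwards [hS.cont] with ω hω
    exact hasRSIntegral_noiselessPath x₀ μ₀ θ₀ hω
  · intro n σ hσ hn hσ0 hnσ
    have hreg : Tendsto (fun k => (n k, σ k)) atTop smallNoise :=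
      tendsto_smallNoise_iff.2 ⟨hn, tendsto_nhdsWithin_iff.2
        ⟨hσ0, Eventually.of_forall fun k => hσ k⟩, hnσ⟩
    have hlim : ∀ᵐ ω ∂P,
        Tendsto (fun k => (σ k)⁻¹ * (lseTheta (n k) (fun t => X (σ k) t ω) - θ₀)) atTop
          (𝓝 (thetaLimit x₀ μ₀ θ₀ (noiselessIntegral x₀ μ₀ θ₀ fun t => S t ω) (S 1 ω))) ∧
        Tendsto (fun k => (σ k)⁻¹ * (lseMu (n k) (fun t => X (σ k) t ω) - μ₀)) atTop
          (𝓝 (muLimit x₀ μ₀ θ₀ (noiselessIntegral x₀ μ₀ θ₀ fun t => S t ω) (S 1 ω))) := by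
      filter_upwards [hS.cont, hS.zero, hQ, ae_all_iff.2 fun k => hX (σ k) (hσ k)]
        with ω hc h0 hq hx
      exact tendsto_lse_of_isVasicekPath hnd hc h0 hq hreg (Eventually.of_forall hx)
    refine ⟨hlim, tendstoInDistribution_of_ae_tendsto (fun k => ?_) ?_ ?_⟩
    · have hm := aemeasurable_lse (hXm (σ k) (hσ k)) (n k)
      exact ((hm.1.sub_const _).const_mul _).prodMk ((hm.2.sub_const _).const_mul _)
    · unfold thetaLimit muLimit
      fun_prop
    · filter_upwards [hlim] with ω hω
      exact hω.1.prodMk_nhds hω.2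
  · intro hX'
    filter_upwards [hS.cont, hS.zero, hQ, hX'] with ω hc h0 hq hx
    exact tendsto_lse_of_isVasicekPath hnd hc h0 hq tendsto_id
      (eventually_pos_smallNoise.mono fun p hp => hx p.2 hp.2)
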